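/- Let $(x_n)_{n\ge 1}$ be a sequence of real numbers in $[0,1]$. Assume that it has an asymptotic distribution function $G$ on $[0,1]$, i.e. that the limit $$G(t)=\lim_{N\to\infty}\frac1N\,\#\{1\le n\le N:\ x_n\in[0,t]\}$$ exists for every $t\in[0,1]$. Write $\|\cdot\|$ for the distance to the nearest integer, and assume that there is a function $F$ with values in $[0,\infty]$ such that $$F(s)=\lim_{N\to\infty}\frac1N\,\#\Big\{(m,n):\ 1\le m,n\le N,\ m\ne n,\ \|x_m-x_n\|\le \frac sN\Big\}\qquad\text{for every } s>0.$$ Here $G(t)$ is regarded as the mass of $[0,t]$ and $G$ is continued by $0$ to the left of $0$, so that $G$ is called absolutely continuous if it is an absolutely continuous function on $[0,1]$ and $G(0)=0$. Then the following hold. (i) If $G$ is not absolutely continuous, then $F(s)=\infty$ for all $s>0$. (ii) If $G$ is absolutely continuous, then the corresponding measure has a density $g$, that is, an integrable function $g\ge 0$ on $[0,1]$ with $G(t)=\int_0^t g(u)\,du$ for all $t\in[0,1]$, and every such density satisfies $$\limsup_{s\to\infty}\frac{F(s)}{2s}\ \ge\ \int_0^1 g(u)^2\,du,$$ where both sides may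 be infinite. -/

import Mathlib

open Set Filter Topology MeasureTheory
open scoped ENNReal

noncomputable section

/-- The distance `‖t‖` from a real number `t` to the nearest integer. -/
def distNearestInt (t : ℝ) : ℝ := |t - round t|

open Classical in
/-- The proportion `(1/N) #{1 ≤ n ≤ N : x n ∈ [0, t]}`. -/
def empiricalCDF (x : ℕ → ℝ) (N : ℕ) (t : ℝ) : ℝ :=
  (((Finset.Icc 1 N).filter fun n => x n ∈ Icc (0 : ℝ) t).card : ℝ) / N

open Classical in
/-- The pair correlation function
`F_N(s) = (1/N) #{1 ≤ m, n ≤ N, m ≠ n : ‖x m - x n‖ ≤ s/N}`. -/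
def pairCorrelation (x : ℕ → ℝ) (N : ℕ) (s : ℝ) : ℝ :=
  (((Finset.Icc 1 N ×ˢ Finset.Icc 1 N).filter fun p =>
    p.1 ≠ p.2 ∧ distNearestInt (x p.1 - x p.2) ≤ s / N).card : ℝ) / N

/-- `G` is the asymptotic distribution function on `[0,1]` of the sequence `x 1, x 2, …`. -/
def IsAsymptoticDistribution (x : ℕ → ℝ) (G : ℝ → ℝ) : Prop :=
  ∀ t ∈ Icc (0 : ℝ) 1, Tendsto (fun N : ℕ => empiricalCDF x N t) atTop (𝓝 (G t))

/-- `F s`, possibly infinite, is the limit of the pair correlation functions for every `s > 0`. -/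
def IsPairCorrelationLimit (x : ℕ → ℝ) (F : ℝ → ℝ≥0∞) : Prop :=
  ∀ s : ℝ, 0 < s →
    Tendsto (fun N : ℕ => ENNReal.ofReal (pairCorrelation x N s)) atTop (𝓝 (F s))

/-- Absolute continuity of a distribution function `G` of a measure on `[0,1]`, `G t` being the
mass of `[0,t]`: `G` is absolutely continuous on `[0,1]` in the usual sense, and it has no jump at
the left end point (`G` is continued by `0` to the left of `0`, so that `G 0` is the mass of
the point `0`). -/
def IsAbsolutelyContinuousDistribution (G : ℝ → ℝ) : Prop :=
  AbsolutelyContinuousOnInterval G 0 1 ∧ G 0 = 0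

/-- `g` is a density, with respect to Lebesgue measure on `[0,1]`, of the measure that gives
mass `G t` to `[0,t]` for `t ∈ [0,1]`. -/
structure IsDensityOfDistribution (G g : ℝ → ℝ) : Prop where
  nonneg : ∀ᵐ u ∂(volume.restrict (Icc (0 : ℝ) 1)), 0 ≤ g u
  integrable : IntegrableOn g (Icc (0 : ℝ) 1)
  integral_eq : ∀ t ∈ Icc (0 : ℝ) 1, ∫ u in Icc (0 : ℝ) t, g u = G t

end

/-! Concentrated mass forces close pairs, by Cauchy–Schwarz. Cut the line into cells of length `r /
N` and slide a window of `K` cells across disjoint intervals `(a i, b i]`. The second moment of the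
window counts is at least the square of their mean, and it counts each pair of points with the Fejér
weight `(K - d)⁺`, where `d` is the difference of cell indices. This weight is the number of `k ≤ K`
with `d < k`, so the second moment is controlled by the pair correlations at the scales `k * r`. As
`N → ∞`, `ofReal_sum_sq_div_le_sum_pairCorrelationLimit` gives `K² r ∑ wᵢ² / (bᵢ - aᵢ) ≤ ∑_{k ≤ K}
(F (k r) + 1)`, where `wᵢ` is the mass of the `i`-th interval.

For (i), take `K = 1`: if mass at least `ε` lies on total length at most `δ`, the left side is at
least `r ε² / δ`, and `δ` is arbitrary. For (ii), if `F s ≤ 2 c s` for large `s`, the right side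
with `r = 1` is `c K² + O(K)`, so `∑ wᵢ² / (bᵢ - aᵢ) ≤ c`. On finer and finer partitions of `[0,1]`,
Lebesgue differentiation and Fatou turn this into `∫ g² ≤ c`. -/

/-! ### Counting close pairs -/

theorem sq_mul_card_sq_le_sum_card_close_pairs {ι : Type*} (S : Finset ι)
    (f : ι → ℤ) (u v : ℤ) (huv : u ≤ v) (hf : ∀ i ∈ S, f i ∈ Icc u v) (K : ℕ) :
    (K : ℝ) ^ 2 * (S.card : ℝ) ^ 2 ≤
      ((v - u + K : ℤ) : ℝ) *
        ∑ k ∈ Finset.Icc 1 K, (((S ×ˢ S).filter fun p => |f p.1 - f p.2| < k).card : ℝ) := by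
  -- The starting points `j` of all windows `[j, j + K)` that meet `[u, v]`; each point lies in
  -- exactly `K` of them.
  set J : Finset ℤ := Finset.Ioc (u - K) v with hJ
  set W : ℤ → Finset ι := fun j => S.filter fun i => j ≤ f i ∧ f i < j + K with hW
  have hJcard : ((v - u + K : ℤ) : ℝ) = (J.card : ℝ) := by
    have : ((J.card : ℕ) : ℤ) = v - u + K := by
      rw [hJ, Int.card_Ioc, Int.toNat_of_nonneg (by omega)]; ring
    exact_mod_cast this.symm
  have hsum : ∑ j ∈ J, (W j).card = K * S.card := by
    have := Finset.sum_card_bipartiteAbove_eq_sum_card_bipartiteBelow (s := J) (t := S)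
      (fun j i => j ≤ f i ∧ f i < j + K)
    simp only [Finset.bipartiteAbove, Finset.bipartiteBelow] at this
    rw [hW, this, Finset.sum_const_nat (m := K), mul_comm]
    intro i hi
    have h := hf i hi
    have : (J.filter fun j => j ≤ f i ∧ f i < j + K) = Finset.Ioc (f i - K) (f i) := by
      ext j
      simp only [hJ, Finset.mem_filter, Finset.mem_Ioc, mem_Icc] at h ⊢
      omega
    rw [this, Int.card_Ioc]
    omega
  have hsq : ∑ j ∈ J, (W j).card ^ 2 ≤
      ∑ k ∈ Finset.Icc 1 K, ((S ×ˢ S).filter fun p => |f p.1 - f p.2| < (k : ℤ)).card := by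
    have h1 := Finset.sum_card_bipartiteAbove_eq_sum_card_bipartiteBelow (s := J) (t := S ×ˢ S)
      (fun j p => (j ≤ f p.1 ∧ f p.1 < j + K) ∧ (j ≤ f p.2 ∧ f p.2 < j + K))
    have h2 := Finset.sum_card_bipartiteAbove_eq_sum_card_bipartiteBelow
      (s := Finset.Icc 1 K) (t := S ×ˢ S) (fun (k : ℕ) p => |f p.1 - f p.2| < (k : ℤ))
    simp only [Finset.bipartiteAbove, Finset.bipartiteBelow] at h1 h2
    rw [h2]
    have h3 : ∀ j, (W j).card ^ 2 = ((S ×ˢ S).filter fun p =>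
        (j ≤ f p.1 ∧ f p.1 < j + K) ∧ (j ≤ f p.2 ∧ f p.2 < j + K)).card := by
      intro j
      rw [sq, ← Finset.card_product]
      congr 1
      ext p
      simp only [hW, Finset.mem_filter, Finset.mem_product]
      tauto
    simp only [h3]
    rw [h1]
    refine Finset.sum_le_sum fun p _ => ?_
    -- A window containing both points starts at some `j` with `max - K < j ≤ min`; then `k = max +
    -- 1 - j` satisfies `max - min < k ≤ K`.
    refine Finset.card_le_card_of_injOn
      (fun j => (max (f p.1) (f p.2) + 1 - j).toNat) ?_ ?_
    · intro j hj
      simp only [Finset.coe_filter, mem_ofPred_eq, Finset.mem_Icc] at hj ⊢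
      obtain ⟨_, h⟩ := hj
      rw [abs_lt]
      omega
    · intro j hj j' hj' h
      simp only [Finset.coe_filter, mem_ofPred_eq] at hj hj' h
      omega
  have hcs : (∑ j ∈ J, ((W j).card : ℝ)) ^ 2 ≤ J.card * ∑ j ∈ J, ((W j).card : ℝ) ^ 2 :=
    sq_sum_le_card_mul_sum_sq
  have hsumR : ∑ j ∈ J, ((W j).card : ℝ) = K * S.card := by exact_mod_cast hsum
  rw [hsumR, mul_pow] at hcs
  rw [hJcard]
  refine hcs.trans ?_
  gcongr
  exact_mod_cast hsq

theorem distNearestInt_le_abs (t : ℝ) : distNearestInt t ≤ |t| := by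
  simpa [distNearestInt] using round_le t 0

theorem abs_sub_le_of_abs_floor_sub_lt {a b q : ℝ} {k : ℕ} (hq : 0 < q)
    (h : |⌊a / q⌋ - ⌊b / q⌋| < (k : ℤ)) : |a - b| ≤ k * q := by
  have ha := Int.floor_le (a / q)
  have ha' := Int.lt_floor_add_one (a / q)
  have hb := Int.floor_le (b / q)
  have hb' := Int.lt_floor_add_one (b / q)
  rw [abs_lt] at h
  have h1 : ((⌊a / q⌋ - ⌊b / q⌋ : ℤ) : ℝ) ≤ k - 1 := by
    have : ⌊a / q⌋ - ⌊b / q⌋ ≤ (k : ℤ) - 1 := by omega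
    exact_mod_cast this
  have h2 : -((k : ℝ) - 1) ≤ ((⌊a / q⌋ - ⌊b / q⌋ : ℤ) : ℝ) := by
    have : -((k : ℤ) - 1) ≤ ⌊a / q⌋ - ⌊b / q⌋ := by omega
    exact_mod_cast this
  push_cast at h1 h2
  have : |a / q - b / q| ≤ k := by rw [abs_le]; constructor <;> linarith
  rwa [← sub_div, abs_div, abs_of_pos hq, div_le_iff₀ hq] at this

theorem empiricalCDF_sub {x : ℕ → ℝ} (hx : ∀ n, 1 ≤ n → 0 ≤ x n) (N : ℕ) {a b : ℝ}
    (hab : a ≤ b) :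
    empiricalCDF x N b - empiricalCDF x N a =
      (((Finset.Icc 1 N).filter fun n => x n ∈ Ioc a b).card : ℝ) / N := by
  classical
  have : (Finset.Icc 1 N).filter (fun n => x n ∈ Icc 0 b) =
      (Finset.Icc 1 N).filter (fun n => x n ∈ Icc 0 a) ∪
        (Finset.Icc 1 N).filter (fun n => x n ∈ Ioc a b) := by
    ext n
    simp only [Finset.mem_filter, Finset.mem_union, Finset.mem_Icc, mem_Icc, mem_Ioc]
    constructor
    · rintro ⟨h, h0, hb⟩
      rcases le_or_gt (x n) a with ha | ha
      · exact Or.inl ⟨h, h0, ha⟩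
      · exact Or.inr ⟨h, ha, hb⟩
    · rintro (⟨h, h0, ha⟩ | ⟨h, ha, hb⟩)
      · exact ⟨h, h0, ha.trans hab⟩
      · exact ⟨h, hx n h.1, hb⟩
  have hd : Disjoint ((Finset.Icc 1 N).filter (fun n => x n ∈ Icc 0 a))
      ((Finset.Icc 1 N).filter (fun n => x n ∈ Ioc a b)) := by
    rw [Finset.disjoint_filter]
    intro n _ h h'
    exact absurd h.2 (not_le.2 h'.1)
  unfold empiricalCDF
  rw [← sub_div]
  congr 1
  have h := Finset.card_union_of_disjoint hd
  rw [← this] at h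
  have h' : (((Finset.Icc 1 N).filter (fun n => x n ∈ Icc 0 b)).card : ℝ) = _ :=
    congrArg Nat.cast h
  push_cast at h'
  linarith

theorem sum_pairCorrelation_ge {x : ℕ → ℝ} (hx : ∀ n, 1 ≤ n → 0 ≤ x n) {ι : Type*}
    (I : Finset ι) (a b : ι → ℝ) (hab : ∀ i ∈ I, a i < b i)
    (hd : (I : Set ι).PairwiseDisjoint fun i => Ioc (a i) (b i))
    {r : ℝ} (hr : 0 < r) (K : ℕ) {N : ℕ} (hN : 0 < N) :
    ∑ i ∈ I, (K : ℝ) ^ 2 * (empiricalCDF x N (b i) - empiricalCDF x N (a i)) ^ 2 /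
        ((b i - a i) / r + (1 + K) / N) ≤
      ∑ k ∈ Finset.Icc 1 K, (pairCorrelation x N (k * r) + 1) := by
  classical
  have hN' : (0 : ℝ) < N := by exact_mod_cast hN
  have hq : 0 < r / N := by positivity
  set f : ℕ → ℤ := fun n => ⌊x n / (r / N)⌋
  set S : ι → Finset ℕ := fun i => (Finset.Icc 1 N).filter fun n => x n ∈ Ioc (a i) (b i)
  set C : ι → ℕ → Finset (ℕ × ℕ) := fun i k => (S i ×ˢ S i).filter fun p => |f p.1 - f p.2| < k
  have h1 : ∀ i ∈ I, (K : ℝ) ^ 2 * (empiricalCDF x N (b i) - empiricalCDF x N (a i)) ^ 2 /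
        ((b i - a i) / r + (1 + K) / N) ≤ (∑ k ∈ Finset.Icc 1 K, ((C i k).card : ℝ)) / N := by
    intro i hi
    have hL := sub_pos.2 (hab i hi)
    rw [empiricalCDF_sub hx N (hab i hi).le, div_le_iff₀ (by positivity)]
    have h := sq_mul_card_sq_le_sum_card_close_pairs (S i) f
      ⌊a i / (r / N)⌋ ⌊b i / (r / N)⌋
      (Int.floor_le_floor (div_le_div_of_nonneg_right (hab i hi).le hq.le)) (by
        intro n hn
        have hn := (Finset.mem_filter.1 hn).2
        exact ⟨Int.floor_le_floor (div_le_div_of_nonneg_right hn.1.le hq.le),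
          Int.floor_le_floor (div_le_div_of_nonneg_right hn.2 hq.le)⟩) K
    -- Rounding the end points to cells costs at most one cell, hence `1 + K`; this vanishes after
    -- division by `N`.
    have hlen : ((⌊b i / (r / N)⌋ - ⌊a i / (r / N)⌋ + K : ℤ) : ℝ) ≤
        N * ((b i - a i) / r + (1 + K) / N) := by
      have e1 := Int.floor_le (b i / (r / N))
      have e2 := Int.lt_floor_add_one (a i / (r / N))
      have e3 : N * ((b i - a i) / r + (1 + K) / N) =
          b i / (r / N) - a i / (r / N) + (1 + K) := by field_simp
      rw [e3]
      push_cast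
      linarith
    have hs : (0 : ℝ) ≤ ∑ k ∈ Finset.Icc 1 K, ((C i k).card : ℝ) := by positivity
    have h := h.trans (mul_le_mul_of_nonneg_right hlen hs)
    rw [div_pow, mul_div_assoc', div_le_iff₀ (by positivity)]
    calc _ ≤ _ := h
      _ = _ := by
        field_simp
        rfl
  refine (Finset.sum_le_sum h1).trans ?_
  rw [← Finset.sum_div, Finset.sum_comm, Finset.sum_div]
  refine Finset.sum_le_sum fun k _ => ?_
  rw [div_le_iff₀ hN', pairCorrelation, add_mul, div_mul_cancel₀ _ hN'.ne', one_mul]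
  set P := (Finset.Icc 1 N ×ˢ Finset.Icc 1 N).filter fun p : ℕ × ℕ =>
    p.1 ≠ p.2 ∧ distNearestInt (x p.1 - x p.2) ≤ k * r / N
  have hdisj : (I : Set ι).PairwiseDisjoint fun i => C i k := by
    intro i hi j hj hij
    refine Finset.disjoint_left.2 fun p hp hp' => ?_
    simp only [C, S, Finset.mem_filter, Finset.mem_product] at hp hp'
    exact Set.disjoint_left.1 (hd hi hj hij) hp.1.1.2 hp'.1.1.2
  -- The diagonal pairs are not counted by `pairCorrelation`; there are `N` of them, whence the `+
  -- 1`.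
  have hsub : I.biUnion (fun i => C i k) ⊆ P ∪ (Finset.Icc 1 N).diag := by
    intro p hp
    simp only [C, S, Finset.mem_biUnion, Finset.mem_filter, Finset.mem_product] at hp
    obtain ⟨i, _, ⟨⟨h1, _⟩, ⟨h2, _⟩⟩, h3⟩ := hp
    by_cases hpp : p.1 = p.2
    · exact Finset.mem_union_right _ (Finset.mem_diag.2 ⟨h1, hpp⟩)
    · refine Finset.mem_union_left _ (Finset.mem_filter.2
        ⟨Finset.mem_product.2 ⟨h1, h2⟩, hpp, ?_⟩)
      refine (distNearestInt_le_abs _).trans ?_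
      rw [mul_div_assoc]
      exact abs_sub_le_of_abs_floor_sub_lt hq h3
  have hcard := (Finset.card_le_card hsub).trans (Finset.card_union_le _ _)
  rw [Finset.card_biUnion hdisj, Finset.diag_card, Nat.card_Icc, Nat.add_sub_cancel] at hcard
  exact_mod_cast hcard

theorem ofReal_sum_sq_div_le_sum_pairCorrelationLimit {x : ℕ → ℝ}
    (hx : ∀ n, 1 ≤ n → 0 ≤ x n) {F : ℝ → ℝ≥0∞} (hF : IsPairCorrelationLimit x F)
    {ι : Type*} (I : Finset ι) (a b w : ι → ℝ) (hab : ∀ i ∈ I, a i < b i)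
    (hd : (I : Set ι).PairwiseDisjoint fun i => Ioc (a i) (b i))
    (hw : ∀ i ∈ I, Tendsto (fun N => empiricalCDF x N (b i) - empiricalCDF x N (a i)) atTop
      (𝓝 (w i)))
    {r : ℝ} (hr : 0 < r) (K : ℕ) :
    ENNReal.ofReal ((K : ℝ) ^ 2 * r * ∑ i ∈ I, w i ^ 2 / (b i - a i)) ≤
      ∑ k ∈ Finset.Icc 1 K, (F (k * r) + 1) := by
  have hlim : Tendsto (fun N : ℕ => ENNReal.ofReal (∑ i ∈ I, (K : ℝ) ^ 2 *
      (empiricalCDF x N (b i) - empiricalCDF x N (a i)) ^ 2 /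
        ((b i - a i) / r + (1 + K) / N))) atTop
      (𝓝 (ENNReal.ofReal (∑ i ∈ I, (K : ℝ) ^ 2 * w i ^ 2 / ((b i - a i) / r + 0)))) := by
    refine ENNReal.tendsto_ofReal (tendsto_finsetSum _ fun i hi => ?_)
    have hL := sub_pos.2 (hab i hi)
    refine (((hw i hi).pow 2).const_mul _).div
      (tendsto_const_nhds.add (tendsto_const_div_atTop_nhds_zero_nat _)) ?_
    positivity
  have hlim' : Tendsto (fun N : ℕ => ∑ k ∈ Finset.Icc 1 K,
      (ENNReal.ofReal (pairCorrelation x N (k * r)) + 1)) atTop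
      (𝓝 (∑ k ∈ Finset.Icc 1 K, (F (k * r) + 1))) := by
    refine tendsto_finsetSum _ fun k hk => (hF _ ?_).add tendsto_const_nhds
    have : (0 : ℝ) < k := by exact_mod_cast (Finset.mem_Icc.1 hk).1
    positivity
  have heq : (K : ℝ) ^ 2 * r * ∑ i ∈ I, w i ^ 2 / (b i - a i) =
      ∑ i ∈ I, (K : ℝ) ^ 2 * w i ^ 2 / ((b i - a i) / r + 0) := by
    rw [Finset.mul_sum]
    refine Finset.sum_congr rfl fun i hi => ?_
    have hL := (sub_pos.2 (hab i hi)).ne'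
    rw [add_zero]
    field_simp
  rw [heq]
  refine le_of_tendsto_of_tendsto hlim hlim' ?_
  filter_upwards [eventually_gt_atTop 0] with N hN
  have hpc : ∀ s, 0 ≤ pairCorrelation x N s := fun s => by unfold pairCorrelation; positivity
  have h := ENNReal.ofReal_le_ofReal (sum_pairCorrelation_ge hx I a b hab hd hr K hN)
  refine h.trans_eq ?_
  rw [ENNReal.ofReal_sum_of_nonneg fun k _ => add_nonneg (hpc _) zero_le_one]
  refine Finset.sum_congr rfl fun k _ => ?_
  rw [ENNReal.ofReal_add (hpc _) zero_le_one, ENNReal.ofReal_one]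

/-! ### Distributions that are not absolutely continuous -/

theorem ENNReal.eq_top_of_forall_ofReal_div_le {y : ℝ≥0∞} {c : ℝ} (hc : 0 < c)
    (h : ∀ δ : ℝ, 0 < δ → ENNReal.ofReal (c / δ) ≤ y + 1) : y = ⊤ := by
  by_contra hy
  lift y to NNReal using hy
  have h1 := h (c / (y + 2)) (by positivity)
  rw [div_div_cancel₀ hc.ne'] at h1
  have h2 : ((y : ℝ≥0∞) + 1) = ENNReal.ofReal (y + 1) := by
    rw [ENNReal.ofReal_add y.coe_nonneg zero_le_one]
    simp
  rw [h2, ENNReal.ofReal_le_ofReal_iff (by positivity)] at h1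
  linarith

theorem empiricalCDF_mono {x : ℕ → ℝ} (hx : ∀ n, 1 ≤ n → 0 ≤ x n) (N : ℕ) :
    Monotone (empiricalCDF x N) := by
  intro a b hab
  have := empiricalCDF_sub hx N hab
  have h : (0 : ℝ) ≤ empiricalCDF x N b - empiricalCDF x N a := by rw [this]; positivity
  linarith

theorem empiricalCDF_of_neg (x : ℕ → ℝ) (N : ℕ) {t : ℝ} (ht : t < 0) :
    empiricalCDF x N t = 0 := by
  simp [empiricalCDF, Icc_eq_empty_of_lt ht]

theorem IsAsymptoticDistribution.monotoneOn {x : ℕ → ℝ} (hx : ∀ n, 1 ≤ n → 0 ≤ x n) {G : ℝ → ℝ}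
    (hG : IsAsymptoticDistribution x G) : MonotoneOn G (Icc 0 1) := fun _ ha _ hb hab =>
  le_of_tendsto_of_tendsto' (hG _ ha) (hG _ hb) fun N => empiricalCDF_mono hx N hab

theorem IsPairCorrelationLimit.mono {x : ℕ → ℝ} {F : ℝ → ℝ≥0∞} (hF : IsPairCorrelationLimit x F)
    {s t : ℝ} (hs : 0 < s) (hst : s ≤ t) : F s ≤ F t := by
  refine le_of_tendsto_of_tendsto' (hF s hs) (hF t (hs.trans_le hst)) fun N => ?_
  refine ENNReal.ofReal_le_ofReal ?_
  unfold pairCorrelation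
  gcongr with p hp hpq

theorem pairCorrelationLimit_eq_top_of_atom {x : ℕ → ℝ} (hx : ∀ n, 1 ≤ n → 0 ≤ x n) {G : ℝ → ℝ}
    (hG : IsAsymptoticDistribution x G) {F : ℝ → ℝ≥0∞} (hF : IsPairCorrelationLimit x F)
    (h0 : G 0 ≠ 0) {s : ℝ} (hs : 0 < s) : F s = ⊤ := by
  refine ENNReal.eq_top_of_forall_ofReal_div_le (c := s * G 0 ^ 2) (by positivity) fun δ hδ => ?_
  -- The interval `(-δ, 0]` carries the whole atom at `0`, since no point is negative.
  have h := ofReal_sum_sq_div_le_sum_pairCorrelationLimit hx hF {()} (fun _ => -δ) (fun _ => 0)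
    (fun _ => G 0) (by simpa using hδ) (by simp) (by
      intro _ _
      simpa [empiricalCDF_of_neg x _ (neg_lt_zero.2 hδ)] using hG 0 (by simp)) hs 1
  simpa [mul_div_assoc] using h

theorem pairCorrelationLimit_eq_top_of_not_absolutelyContinuous {x : ℕ → ℝ}
    (hx : ∀ n, 1 ≤ n → 0 ≤ x n) {G : ℝ → ℝ}
    (hG : IsAsymptoticDistribution x G) {F : ℝ → ℝ≥0∞} (hF : IsPairCorrelationLimit x F)
    (hac : ¬ AbsolutelyContinuousOnInterval G 0 1) {s : ℝ} (hs : 0 < s) : F s = ⊤ := by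
  rw [absolutelyContinuousOnInterval_iff] at hac
  push Not at hac
  obtain ⟨ε, hε, hac⟩ := hac
  refine ENNReal.eq_top_of_forall_ofReal_div_le (c := s * ε ^ 2) (by positivity) fun δ hδ => ?_
  obtain ⟨⟨n, E⟩, ⟨hE, hd⟩, hlen, hmass⟩ := hac δ hδ
  simp only [uIcc_of_le (zero_le_one (α := ℝ))] at hE hd hlen hmass
  set a : ℕ → ℝ := fun i => min (E i).1 (E i).2
  set b : ℕ → ℝ := fun i => max (E i).1 (E i).2
  -- Degenerate intervals carry no increment of `G` and are dropped because lengths become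
  -- denominators.
  set I := (Finset.range n).filter fun i => (E i).1 ≠ (E i).2 with hI
  have ha : ∀ i ∈ Finset.range n, a i ∈ Icc (0 : ℝ) 1 := fun i hi =>
    ⟨le_min (hE i hi).1.1 (hE i hi).2.1, min_le_of_left_le (hE i hi).1.2⟩
  have hb : ∀ i ∈ Finset.range n, b i ∈ Icc (0 : ℝ) 1 := fun i hi =>
    ⟨le_max_of_le_left (hE i hi).1.1, max_le (hE i hi).1.2 (hE i hi).2.2⟩
  have hIn : I ⊆ Finset.range n := Finset.filter_subset _ _
  have hab : ∀ i ∈ I, a i < b i := fun i hi => min_lt_max.2 (Finset.mem_filter.1 hi).2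
  have hmass' : ε ≤ ∑ i ∈ I, (G (b i) - G (a i)) := by
    refine hmass.trans_eq ?_
    rw [hI, Finset.sum_filter_of_ne]
    · refine Finset.sum_congr rfl fun i hi => ?_
      have hm := hG.monotoneOn hx
      rw [Real.dist_eq]
      rcases le_total (E i).1 (E i).2 with h | h
      · simp only [a, b, min_eq_left h, max_eq_right h]
        rw [abs_sub_comm, abs_of_nonneg (sub_nonneg.2 (hm (hE i hi).1 (hE i hi).2 h))]
      · simp only [a, b, min_eq_right h, max_eq_left h]
        rw [abs_of_nonneg (sub_nonneg.2 (hm (hE i hi).2 (hE i hi).1 h))]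
    · intro i _ h heq
      exact h (by simp [a, b, heq])
  have hlen' : ∑ i ∈ I, (b i - a i) ≤ δ := by
    refine le_trans ?_ hlen.le
    refine (Finset.sum_le_sum_of_subset_of_nonneg hIn fun i _ _ =>
      sub_nonneg.2 min_le_max).trans_eq ?_
    refine Finset.sum_congr rfl fun i _ => ?_
    rw [Real.dist_eq, max_sub_min_eq_abs']
  have hne : I.Nonempty := by
    rw [Finset.nonempty_iff_ne_empty]
    intro h
    rw [h, Finset.sum_empty] at hmass'
    linarith
  have hpos : 0 < ∑ i ∈ I, (b i - a i) := Finset.sum_pos (fun i hi => sub_pos.2 (hab i hi)) hne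
  have h := ofReal_sum_sq_div_le_sum_pairCorrelationLimit hx hF I a b
    (fun i => G (b i) - G (a i)) hab (hd.subset (by exact_mod_cast hIn))
    (fun i hi => (hG _ (hb i (hIn hi))).sub (hG _ (ha i (hIn hi)))) hs 1
  have hcs := Finset.sq_sum_div_le_sum_sq_div I (fun i => G (b i) - G (a i))
    (g := fun i => b i - a i) fun i hi => sub_pos.2 (hab i hi)
  simp only [Finset.Icc_self, Finset.sum_singleton, Nat.cast_one, one_mul, one_pow] at h
  refine le_trans (ENNReal.ofReal_le_ofReal ?_) h
  rw [mul_div_assoc]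
  refine mul_le_mul_of_nonneg_left (le_trans ?_ hcs) hs.le
  gcongr

/-! ### Densities and their square integrals -/

theorem IsAsymptoticDistribution.isDensity_deriv {x : ℕ → ℝ} (hx : ∀ n, 1 ≤ n → 0 ≤ x n) {G : ℝ → ℝ}
    (hG : IsAsymptoticDistribution x G) (hac : IsAbsolutelyContinuousDistribution G) :
    IsDensityOfDistribution G (deriv G) where
  nonneg := by
    -- `G` is unconstrained outside `[0,1]`, so the sign of `deriv G` is known only at interior
    -- points.
    rw [← restrict_Ioo_eq_restrict_Icc]
    refine (ae_restrict_iff' measurableSet_Ioo).2 (Eventually.of_forall fun u hu => ?_)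
    rw [← derivWithin_of_mem_nhds (Icc_mem_nhds hu.1 hu.2)]
    exact (hG.monotoneOn hx).derivWithin_nonneg
  integrable := by
    rw [integrableOn_Icc_iff_integrableOn_Ioc,
      ← intervalIntegrable_iff_integrableOn_Ioc_of_le zero_le_one]
    exact hac.1.intervalIntegrable_deriv
  integral_eq t ht := by
    rw [integral_Icc_eq_integral_Ioc, ← intervalIntegral.integral_of_le ht.1,
      (hac.1.mono _).integral_deriv_eq_sub, hac.2, sub_zero]
    rw [uIcc_of_le ht.1, uIcc_of_le zero_le_one]
    exact Icc_subset_Icc_right ht.2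

/-- The sums are integrals of squared averages of `h` over the cells of a uniform grid. These
averages converge to `h` almost everywhere, and Fatou's lemma gives the bound even when `h ^ 2` is
not known to be integrable. -/
theorem lintegral_sq_le_of_forall_sum_average_le {h : ℝ → ℝ} (hh : Integrable h) {c : ℝ≥0∞}
    (hc : ∀ M : ℕ, 0 < M → ENNReal.ofReal (∑ i ∈ Finset.range M,
      (∫ y in Ioc ((i : ℝ) / M) ((i + 1) / M), h y) ^ 2 / ((i + 1) / M - (i : ℝ) / M)) ≤ c) :
    ∫⁻ u in Icc (0 : ℝ) 1, ENNReal.ofReal (h u ^ 2) ≤ c := by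
  -- `φ M u` is the squared average of `h` over the grid cell of length `1 / M` containing `u`.
  set φ : ℕ → ℝ → ℝ≥0∞ := fun M u =>
    ENNReal.ofReal ((M * ∫ y in Ioc ((⌈u * M⌉ - 1 : ℝ) / M) (⌈u * M⌉ / M), h y) ^ 2)
  have hφ : ∀ M, Measurable (φ M) := fun M =>
    (measurable_of_countable fun z : ℤ =>
      ENNReal.ofReal ((M * ∫ y in Ioc ((z - 1 : ℝ) / M) (z / M), h y) ^ 2)).comp
      (Int.measurable_ceil.comp (measurable_id.mul_const (M : ℝ)))
  have hlim : ∀ᵐ u : ℝ, Tendsto (fun M => φ M u) atTop (𝓝 (ENNReal.ofReal (h u ^ 2))) := by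
    -- The cells contain `u` but are not centred at it, so differentiation is needed along balls
    -- with moving centres.
    filter_upwards [IsUnifLocDoublingMeasure.ae_tendsto_average (μ := volume)
      hh.locallyIntegrable 1] with u hu
    have hδ : Tendsto (fun M : ℕ => (1 / 2 : ℝ) / M) atTop (𝓝[>] 0) := by
      refine tendsto_nhdsWithin_iff.2 ⟨tendsto_const_div_atTop_nhds_zero_nat _, ?_⟩
      filter_upwards [eventually_gt_atTop 0] with M hM
      have : (0 : ℝ) < M := by exact_mod_cast hM
      exact div_pos one_half_pos this
    have hball : ∀ M : ℕ,
        Metric.closedBall ((⌈u * M⌉ - 1 / 2 : ℝ) / M) ((1 / 2 : ℝ) / M) =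
          Icc ((⌈u * M⌉ - 1 : ℝ) / M) (⌈u * M⌉ / M) := by
      intro M
      rw [Real.closedBall_eq_Icc]
      congr 1 <;> ring
    have key := hu (fun M : ℕ => (⌈u * M⌉ - 1 / 2 : ℝ) / M) (fun M : ℕ => (1 / 2 : ℝ) / M) hδ (by
      filter_upwards [eventually_gt_atTop 0] with M hM
      have hM' : (0 : ℝ) < M := by exact_mod_cast hM
      rw [one_mul, hball, mem_Icc, div_le_iff₀ hM', le_div_iff₀ hM']
      have h1 := Int.ceil_lt_add_one (u * M)
      exact ⟨by linarith, Int.le_ceil _⟩)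
    refine ENNReal.tendsto_ofReal ((key.congr' ?_).pow 2)
    filter_upwards [eventually_gt_atTop 0] with M hM
    have hM' : (0 : ℝ) < M := by exact_mod_cast hM
    rw [hball, setAverage_eq, integral_Icc_eq_integral_Ioc,
      Real.volume_real_Icc_of_le (by gcongr; linarith), smul_eq_mul]
    congr 1
    field_simp
    ring
  have hint : ∀ M, ∫⁻ u in Icc (0 : ℝ) 1, φ M u ≤ c := by
    intro M
    rcases Nat.eq_zero_or_pos M with rfl | hM
    · simp [φ]
    have hM' : (0 : ℝ) < M := by exact_mod_cast hM
    have hsub : Ioc (0 : ℝ) 1 ⊆ ⋃ i : Fin M, Ioc ((i : ℝ) / M) ((i + 1) / M) := by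
      intro u hu
      have hpos : 0 < ⌈u * M⌉₊ := Nat.ceil_pos.2 (mul_pos hu.1 hM')
      have hle : ⌈u * M⌉₊ ≤ M := Nat.ceil_le.2 (mul_le_of_le_one_left hM'.le hu.2)
      refine mem_iUnion.2 ⟨⟨⌈u * M⌉₊ - 1, by omega⟩, ?_⟩
      have h1 := Nat.le_ceil (u * M)
      have h2 := Nat.ceil_lt_add_one (mul_pos hu.1 hM').le
      simp only [mem_Ioc, Nat.cast_pred hpos]
      rw [div_lt_iff₀ hM', le_div_iff₀ hM']
      constructor <;> linarith
    have hpiece : ∀ i : ℕ, ∫⁻ u in Ioc ((i : ℝ) / M) ((i + 1) / M), φ M u =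
        ENNReal.ofReal ((∫ y in Ioc ((i : ℝ) / M) ((i + 1) / M), h y) ^ 2 /
          ((i + 1) / M - (i : ℝ) / M)) := by
      intro i
      have hconst : ∀ u ∈ Ioc ((i : ℝ) / M) ((i + 1) / M), φ M u =
          ENNReal.ofReal ((M * ∫ y in Ioc ((i : ℝ) / M) ((i + 1) / M), h y) ^ 2) := by
        intro u hu
        have : ⌈u * M⌉ = (i : ℤ) + 1 := by
          rw [Int.ceil_eq_iff]
          have h1 := (div_lt_iff₀ hM').1 hu.1
          have h2 := (le_div_iff₀ hM').1 hu.2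
          push_cast
          constructor <;> linarith
        simp [φ, this]
      rw [setLIntegral_congr_fun measurableSet_Ioc hconst, setLIntegral_const, Real.volume_Ioc,
        ← ENNReal.ofReal_mul (by positivity)]
      congr 1
      field_simp
      ring
    rw [← restrict_Ioc_eq_restrict_Icc]
    calc ∫⁻ u in Ioc (0 : ℝ) 1, φ M u
        ≤ ∫⁻ u in ⋃ i : Fin M, Ioc ((i : ℝ) / M) ((i + 1) / M), φ M u := lintegral_mono_set hsub
      _ ≤ ∑' i : Fin M, ∫⁻ u in Ioc ((i : ℝ) / M) ((i + 1) / M), φ M u := lintegral_iUnion_le _ _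
      _ = ENNReal.ofReal (∑ i ∈ Finset.range M,
          (∫ y in Ioc ((i : ℝ) / M) ((i + 1) / M), h y) ^ 2 / ((i + 1) / M - (i : ℝ) / M)) := by
        rw [tsum_fintype, ENNReal.ofReal_sum_of_nonneg, ← Fin.sum_univ_eq_sum_range
          (fun i => ENNReal.ofReal ((∫ y in Ioc ((i : ℝ) / M) ((i + 1) / M), h y) ^ 2 /
          ((i + 1) / M - (i : ℝ) / M)))]
        · exact Finset.sum_congr rfl fun i _ => hpiece i
        · intro i _
          have : (i : ℝ) / M ≤ (i + 1) / M := by gcongr; linarith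
          exact div_nonneg (sq_nonneg _) (sub_nonneg.2 this)
      _ ≤ c := hc M hM
  calc ∫⁻ u in Icc (0 : ℝ) 1, ENNReal.ofReal (h u ^ 2)
      = ∫⁻ u in Icc (0 : ℝ) 1, liminf (fun M => φ M u) atTop :=
        lintegral_congr_ae ((ae_restrict_of_ae hlim).mono fun u hu => hu.liminf_eq.symm)
    _ ≤ liminf (fun M => ∫⁻ u in Icc (0 : ℝ) 1, φ M u) atTop := lintegral_liminf_le hφ
    _ ≤ liminf (fun _ : ℕ => c) atTop := liminf_le_liminf (Eventually.of_forall hint)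
    _ = c := liminf_const c

/-- The right side is `c K² + O(K)`; compare the coefficients of `K²`. -/
theorem le_of_forall_sq_mul_le_sum {A b c : ℝ}
    (h : ∀ K : ℕ, (K : ℝ) ^ 2 * A ≤ ∑ k ∈ Finset.Icc 1 K, (b + c * (2 * k) + 1)) : A ≤ c := by
  have hsum : ∀ K : ℕ, ∑ k ∈ Finset.Icc 1 K, (b + c * (2 * (k : ℝ)) + 1) =
      K * (b + 1) + c * (K * (K + 1)) := by
    intro K
    induction K with
    | zero => simp
    | succ K ih =>
      rw [Finset.sum_Icc_succ_top (by omega), ih]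
      push_cast
      ring
  by_contra! hA
  obtain ⟨K, hK⟩ := exists_nat_gt (max 0 ((b + 1 + c) / (A - c)))
  have hK0 : (0 : ℝ) < K := (le_max_left _ _).trans_lt hK
  have hK1 := (div_lt_iff₀ (sub_pos.2 hA)).1 ((le_max_right _ _).trans_lt hK)
  have h1 := h K
  rw [hsum] at h1
  nlinarith [mul_pos hK0 (sub_pos.2 hK1)]

/-! ### The lower bound for the limsup -/

theorem sum_sq_div_le_of_pairCorrelationLimit_le {x : ℕ → ℝ}
    (hx : ∀ n, 1 ≤ n → 0 ≤ x n) {F : ℝ → ℝ≥0∞} (hF : IsPairCorrelationLimit x F)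
    {c : NNReal} (hc : ∀ᶠ s in atTop, F s ≤ c * ENNReal.ofReal (2 * s))
    {ι : Type*} (I : Finset ι) (a b w : ι → ℝ) (hab : ∀ i ∈ I, a i < b i)
    (hd : (I : Set ι).PairwiseDisjoint fun i => Ioc (a i) (b i))
    (hw : ∀ i ∈ I, Tendsto (fun N => empiricalCDF x N (b i) - empiricalCDF x N (a i)) atTop
      (𝓝 (w i))) :
    ∑ i ∈ I, w i ^ 2 / (b i - a i) ≤ c := by
  obtain ⟨s₀, hs₀⟩ := eventually_atTop.1 (hc.and (eventually_gt_atTop 0))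
  have hpos : 0 < s₀ := (hs₀ s₀ le_rfl).2
  have hB : F s₀ ≠ ⊤ := ne_top_of_le_ne_top
    (ENNReal.mul_ne_top ENNReal.coe_ne_top ENNReal.ofReal_ne_top) (hs₀ s₀ le_rfl).1
  refine le_of_forall_sq_mul_le_sum (b := (F s₀).toReal) fun K => ?_
  have h := ofReal_sum_sq_div_le_sum_pairCorrelationLimit hx hF I a b w hab hd hw one_pos K
  -- The linear bound is available only from `s₀` on; below it, monotonicity bounds `F` by the
  -- constant `F s₀`.
  have hbound : ∀ k ∈ Finset.Icc 1 K, F (k * 1) + 1 ≤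
      ENNReal.ofReal ((F s₀).toReal + c * (2 * k) + 1) := by
    intro k hk
    have hk0 : (0 : ℝ) < k := by exact_mod_cast (Finset.mem_Icc.1 hk).1
    rw [ENNReal.ofReal_add (by positivity) zero_le_one, ENNReal.ofReal_one,
      ENNReal.ofReal_add (by positivity) (by positivity), ENNReal.ofReal_toReal hB,
      ENNReal.ofReal_mul c.coe_nonneg, ENNReal.ofReal_coe_nnreal, mul_one]
    gcongr
    rcases le_total (k : ℝ) s₀ with hle | hle
    · exact (hF.mono hk0 hle).trans le_self_add
    · exact (hs₀ k hle).1.trans le_add_self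
  have h' := h.trans (Finset.sum_le_sum hbound)
  rw [← ENNReal.ofReal_sum_of_nonneg fun k _ => by positivity,
    ENNReal.ofReal_le_ofReal_iff (Finset.sum_nonneg fun k _ => by positivity), mul_one] at h'
  exact h'

theorem lintegral_sq_density_le_limsup {x : ℕ → ℝ} (hx : ∀ n, 1 ≤ n → 0 ≤ x n) {G : ℝ → ℝ}
    (hG : IsAsymptoticDistribution x G) {F : ℝ → ℝ≥0∞} (hF : IsPairCorrelationLimit x F)
    {g : ℝ → ℝ} (hg : IsDensityOfDistribution G g) :
    ∫⁻ u in Icc (0 : ℝ) 1, ENNReal.ofReal (g u ^ 2) ≤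
      limsup (fun s : ℝ => F s / ENNReal.ofReal (2 * s)) atTop := by
  by_contra! hlt
  obtain ⟨c, hc₁, hc₂⟩ := ENNReal.lt_iff_exists_nnreal_btwn.1 hlt
  have hev : ∀ᶠ s in atTop, F s ≤ c * ENNReal.ofReal (2 * s) := by
    filter_upwards [eventually_lt_of_limsup_lt hc₁, eventually_gt_atTop 0] with s hs hpos
    have h0 : ENNReal.ofReal (2 * s) ≠ 0 := by
      rw [Ne, ENNReal.ofReal_eq_zero, not_le]
      positivity
    exact (ENNReal.div_le_iff h0 ENNReal.ofReal_ne_top).1 hs.le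
  refine absurd hc₂ (not_lt.2 ?_)
  -- Extending by zero gives a function integrable on the whole line, as differentiation of averages
  -- requires.
  set h := (Icc (0 : ℝ) 1).indicator g
  have hh : Integrable h := (integrable_indicator_iff measurableSet_Icc).2 hg.integrable
  have hgh : ∫⁻ u in Icc (0 : ℝ) 1, ENNReal.ofReal (g u ^ 2) =
      ∫⁻ u in Icc (0 : ℝ) 1, ENNReal.ofReal (h u ^ 2) :=
    setLIntegral_congr_fun measurableSet_Icc fun u hu => by simp only [h, indicator_of_mem hu]
  have hGh : ∀ a b : ℝ, 0 ≤ a → a ≤ b → b ≤ 1 → G b - G a = ∫ y in Ioc a b, h y := by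
    intro a b ha hab hb
    have hint : ∀ t ∈ Icc (0 : ℝ) 1, G t = ∫ y in (0 : ℝ)..t, h y := by
      intro t ht
      rw [intervalIntegral.integral_of_le ht.1, ← integral_Icc_eq_integral_Ioc,
        ← hg.integral_eq t ht]
      exact setIntegral_congr_fun measurableSet_Icc fun u hu => by
        simp only [h, indicator_of_mem (Icc_subset_Icc_right ht.2 hu)]
    rw [hint b ⟨ha.trans hab, hb⟩, hint a ⟨ha, hab.trans hb⟩,
      intervalIntegral.integral_interval_sub_left hh.intervalIntegrable hh.intervalIntegrable,
      intervalIntegral.integral_of_le hab]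
  rw [hgh]
  refine lintegral_sq_le_of_forall_sum_average_le hh fun M hM => ?_
  have hM' : (0 : ℝ) < M := by exact_mod_cast hM
  have hlt : ∀ i ∈ Finset.range M, (i : ℝ) / M < (i + 1) / M := fun i _ => by
    gcongr; linarith
  have hmem : ∀ i ∈ Finset.range M, (0 : ℝ) ≤ (i : ℝ) / M ∧ ((i : ℝ) + 1) / M ≤ 1 := by
    intro i hi
    refine ⟨by positivity, (div_le_one hM').2 ?_⟩
    exact_mod_cast Finset.mem_range.1 hi
  rw [← ENNReal.ofReal_coe_nnreal]
  refine ENNReal.ofReal_le_ofReal ?_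
  refine sum_sq_div_le_of_pairCorrelationLimit_le hx hF hev (Finset.range M)
    (fun i => (i : ℝ) / M) (fun i => ((i : ℝ) + 1) / M) _ hlt ?_ ?_
  · have hmono : Monotone fun i : ℕ => (i : ℝ) / M := fun i j hij => by
      have : (i : ℝ) ≤ j := by exact_mod_cast hij
      dsimp only
      gcongr
    have := hmono.pairwise_disjoint_on_Ioc_succ
    intro i _ j _ hij
    simpa [Function.onFun, Order.succ_eq_add_one] using this hij
  · intro i hi
    obtain ⟨h0, h1⟩ := hmem i hi
    have hle := (hlt i hi).le
    rw [← hGh _ _ h0 hle h1]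
    exact (hG _ ⟨h0.trans hle, h1⟩).sub (hG _ ⟨h0, hle.trans h1⟩)

theorem theorem2 (x : ℕ → ℝ) (hx : ∀ n : ℕ, 1 ≤ n → x n ∈ Set.Icc (0 : ℝ) 1)
    (G : ℝ → ℝ) (hG : IsAsymptoticDistribution x G)
    (F : ℝ → ℝ≥0∞) (hF : IsPairCorrelationLimit x F) :
    (¬ IsAbsolutelyContinuousDistribution G → ∀ s : ℝ, 0 < s → F s = ⊤) ∧
    (IsAbsolutelyContinuousDistribution G →
      (∃ g : ℝ → ℝ, IsDensityOfDistribution G g) ∧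
      ∀ g : ℝ → ℝ, IsDensityOfDistribution G g →
        ∫⁻ u in Set.Icc (0 : ℝ) 1, ENNReal.ofReal (g u ^ 2) ≤
          Filter.limsup (fun s : ℝ => F s / ENNReal.ofReal (2 * s)) Filter.atTop) := by
  have hx0 : ∀ n, 1 ≤ n → 0 ≤ x n := fun n hn => (hx n hn).1
  refine ⟨fun hac s hs => ?_, fun hac => ⟨⟨_, hG.isDensity_deriv hx0 hac⟩, fun g hg =>
    lintegral_sq_density_le_limsup hx0 hG hF hg⟩⟩
  by_cases h0 : G 0 = 0
  · exact pairCorrelationLimit_eq_top_of_not_absolutelyContinuous hx0 hG hF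
      (fun h => hac ⟨h, h0⟩) hs
  · exact pairCorrelationLimit_eq_top_of_atom hx0 hG hF h0 hs
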